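/- **Pressure law.** Let $p$ be a pressure function that is $C^2$ on $(0,\infty)$, with $p'(\rho)>0$ and $\rho p''(\rho)+2p'(\rho)>0$ for all $\rho>0$, such that $p(\rho)=\rho$ for $\rho\ge 1$, and such that, for some $\gamma\in(1,3)$, $\kappa>0$, $M>0$ and with $\theta=\frac{\gamma-1}{2}$, one has $p(\rho)=\kappa\rho^\gamma(1+P(\rho))$ for $0\le\rho\le1$, where $P$ is $C^3$ on $(0,1]$ and $|P^{(n)}(\rho)|\le M\rho^{2\theta-n}$ for $n=0,1,2,3$ and $0<\rho\le1$. **Kernels.** Let $\chi=\chi(\rho,u,s)$ be an entropy kernel, i.e. for every $s\in\mathbb R$ $$\chi_{\rho\rho}-\frac{p'(\rho)}{\rho^2}\chi_{uu}=0\quad(\rho>0),\qquad \chi|_{\rho=0}=0,\qquad \chi_\rho|_{\rho=0}=\delta_{u=s},$$ and let $\sigma=\sigma(\rho,u,s)$ be an associated entropy flux kernel, i.e. for every $s\in\mathbb R$ $$(\sigma-u\chi)_{\rho\rho}-\frac{p'(\rho)}{\rho^2}(\sigma-u\chi)_{uu}=\frac{p''(\rho)}{\rho}\chi_u\quad(\rho>0),\qquad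 (\sigma-u\chi)|_{\rho=0}=0,\qquad (\sigma-u\chi)_\rho|_{\rho=0}=0.$$ Both problems are understood weakly in $u$. That is, for fixed $s$ the functions $g=\chi$ and $g=\sigma-u\chi$ are locally integrable in $(\rho,u)\in(0,\infty)\times\mathbb R$ and, for each $\rho>0$, in $u$; for each $\varphi\in C_c^\infty(\mathbb R)$ the function $\rho\mapsto\int g(\rho,u,s)\varphi(u)\,du$ is twice differentiable on $(0,\infty)$ and satisfies the equation tested against $\varphi$; and this function and its $\rho$-derivative attain the initial data as $\rho\to0^+$. The symbol $g_\rho(\rho,\cdot,s)$ denotes the distribution $\varphi\mapsto\frac{d}{d\rho}\int g(\rho,u,s)\varphi(u)\,du$. **Theorem.** For every $\rho\ge1$ and $s\in\mathbb R$, as distributions in $u$ and with convolution in $u$, $$\begin{aligned}\chi(\rho,\cdot,s)&=\chi_\rho(1,\cdot,s)*\chi^\sharp(\rho,\cdot)+\chi(1,\cdot,s)*\chi^\flat(\rho,\cdot),\\ (\sigma-u\chi)(\rho,\cdot,s)&=(\sigma-u\chi)_\rho(1,\cdot,s)*\chi^\sharp(\rho,\cdot)+(\sigma-u\chi)(1,\cdot,s)*\chi^\flat(\rho,\cdot),\end{aligned}$$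 where, with $I_0,I_1$ the modified Bessel functions of the first kind, $$\chi^\sharp(\rho,v)=\tfrac12\sqrt\rho\, I_0\Big(\tfrac{\sqrt{(\log\rho)^2-|v|^2}}{2}\Big)\mathbf 1_{|v|<\log\rho},$$ and $\chi^\flat(\rho,\cdot)$ is the measure $$\begin{aligned}\chi^\flat(\rho,v)=&\ \tfrac12\sqrt\rho\,\big(\delta_{v=\log\rho}+\delta_{v=-\log\rho}\big)-\tfrac14\sqrt\rho\, I_0\Big(\tfrac{\sqrt{(\log\rho)^2-|v|^2}}{2}\Big)\mathbf 1_{|v|<\log\rho}\\&+\tfrac14\sqrt\rho\,\frac{\log\rho}{\sqrt{(\log\rho)^2-|v|^2}}\,I_1\Big(\tfrac{\sqrt{(\log\rho)^2-|v|^2}}{2}\Big)\mathbf 1_{|v|<\log\rho}.\end{aligned}$$ -/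

import Mathlib

open MeasureTheory Set Filter Topology
open scoped ContDiff

noncomputable section

/-- The pressure laws under consideration, normalised so that the two constants that fix
the high-density regime (threshold and slope) are both one: an approximate `γ`-law with
`γ ∈ (1,3)` on `[0,1]`, exactly `p(ρ) = ρ` on `[1,∞)`, strictly hyperbolic and genuinely
nonlinear on `(0,∞)`. Here `2θ = γ - 1`. -/
structure IsPressureLaw (p : ℝ → ℝ) : Prop where
  contDiffOn : ContDiffOn ℝ 2 p (Ioi 0)
  low_density : ∃ γ κ M : ℝ, ∃ P : ℝ → ℝ, 1 < γ ∧ γ < 3 ∧ 0 < κ ∧ 0 < M ∧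
    (∀ ρ ∈ Icc (0 : ℝ) 1, p ρ = κ * ρ ^ γ * (1 + P ρ)) ∧
    ContDiffOn ℝ 3 P (Ioc 0 1) ∧
    ∀ n : ℕ, n ≤ 3 → ∀ ρ ∈ Ioc (0 : ℝ) 1,
      |iteratedDerivWithin n P (Ioc 0 1) ρ| ≤ M * ρ ^ ((γ - 1) - (n : ℝ))
  high_density : ∀ ρ : ℝ, 1 ≤ ρ → p ρ = ρ
  strictly_hyperbolic : ∀ ρ : ℝ, 0 < ρ → 0 < deriv p ρ
  genuinely_nonlinear : ∀ ρ : ℝ, 0 < ρ → 0 < ρ * deriv (deriv p) ρ + 2 * deriv p ρ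

/-- Test functions on the line: smooth with compact support. -/
def IsTest (φ : ℝ → ℝ) : Prop := ContDiff ℝ ∞ φ ∧ HasCompactSupport φ

/-- The action `φ ↦ ∫ g φ` of a (locally integrable) function `g` on test functions. -/
def distOf (g : ℝ → ℝ) (φ : ℝ → ℝ) : ℝ := ∫ u, g u * φ u

/-- The derivative at `ρ` of a one-parameter family of distributions `T`, i.e. the
distribution `φ ↦ d/dρ ⟨T ρ, φ⟩`. -/
def paramDeriv (T : ℝ → (ℝ → ℝ) → ℝ) (ρ : ℝ) (φ : ℝ → ℝ) : ℝ := deriv (fun r => T r φ) ρ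

/-- Convolution of distributions on the line (the second one compactly supported):
`⟨T * S, φ⟩ = ⟨T_u, ⟨S_w, φ(u + w)⟩⟩`. -/
def distConv (T S : (ℝ → ℝ) → ℝ) (φ : ℝ → ℝ) : ℝ := T (fun u => S (fun w => φ (u + w)))

/-- `g = g(ρ, u)`, `ρ > 0`, is a (weak) solution of the Cauchy problem
`g_ρρ - (p'(ρ)/ρ²) g_uu = F(ρ)`, `g|_{ρ=0} = g₀`, `g_ρ|_{ρ=0} = g₁`,
where `F(ρ)`, `g₀`, `g₁` are distributions in `u`: `g` is locally integrable, and for each test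
function `φ` the function `ρ ↦ ⟨g(ρ,·), φ⟩` is twice differentiable on `(0,∞)`, satisfies the
equation tested with `φ`, and attains the data as `ρ → 0+`. -/
structure IsWeakSolution (p : ℝ → ℝ) (F : ℝ → (ℝ → ℝ) → ℝ) (g₀ g₁ : (ℝ → ℝ) → ℝ)
    (g : ℝ → ℝ → ℝ) : Prop where
  locallyIntegrableOn :
    LocallyIntegrableOn (fun x : ℝ × ℝ => g x.1 x.2) (Ioi (0 : ℝ) ×ˢ univ)
  locallyIntegrable_slice : ∀ ρ : ℝ, 0 < ρ → LocallyIntegrable (g ρ)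
  differentiableAt : ∀ φ, IsTest φ → ∀ ρ : ℝ, 0 < ρ →
    DifferentiableAt ℝ (fun r => distOf (g r) φ) ρ
  equation : ∀ φ, IsTest φ → ∀ ρ : ℝ, 0 < ρ →
    HasDerivAt (fun r => paramDeriv (fun r' => distOf (g r')) r φ)
      (deriv p ρ / ρ ^ 2 * distOf (g ρ) (deriv (deriv φ)) + F ρ φ) ρ
  initial_value : ∀ φ, IsTest φ →
    Tendsto (fun ρ => distOf (g ρ) φ) (𝓝[>] 0) (𝓝 (g₀ φ))
  initial_deriv : ∀ φ, IsTest φ →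
    Tendsto (fun ρ => paramDeriv (fun r => distOf (g r)) ρ φ) (𝓝[>] 0) (𝓝 (g₁ φ))

/-- `χ = χ(ρ, u, s)` is an entropy kernel for the pressure `p`: for every `s`,
`χ_ρρ - (p'(ρ)/ρ²) χ_uu = 0`, `χ|_{ρ=0} = 0`, `χ_ρ|_{ρ=0} = δ_{u=s}`. -/
def IsEntropyKernel (p : ℝ → ℝ) (χ : ℝ → ℝ → ℝ → ℝ) : Prop :=
  ∀ s : ℝ, IsWeakSolution p (fun _ _ => 0) (fun _ => 0) (fun φ => φ s) (fun ρ u => χ ρ u s)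

/-- `σ = σ(ρ, u, s)` is an entropy flux kernel associated with `χ`: for every `s`, the function
`h = σ - u χ` solves `h_ρρ - (p'(ρ)/ρ²) h_uu = (p''(ρ)/ρ) χ_u`, `h|_{ρ=0} = 0`,
`h_ρ|_{ρ=0} = 0`; the distributional derivative is `⟨χ_u, φ⟩ = -⟨χ, φ'⟩`. -/
def IsEntropyFluxKernel (p : ℝ → ℝ) (χ σ : ℝ → ℝ → ℝ → ℝ) : Prop :=
  ∀ s : ℝ, IsWeakSolution p
    (fun ρ φ => deriv (deriv p) ρ / ρ * -distOf (fun u => χ ρ u s) (deriv φ))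
    (fun _ => 0) (fun _ => 0) (fun ρ u => σ ρ u s - u * χ ρ u s)

/-- The modified Bessel function of the first kind `I_n` of integer order `n ≥ 0`. -/
def besselI (n : ℕ) (x : ℝ) : ℝ :=
  ∑' k : ℕ, (x / 2) ^ (2 * k + n) / ((k.factorial : ℝ) * ((k + n).factorial : ℝ))

/-- The function `v ↦ χ^♯(ρ, v)`. -/
def chiSharp (ρ v : ℝ) : ℝ :=
  if |v| < Real.log ρ then
    1 / 2 * √ρ * besselI 0 (√(Real.log ρ ^ 2 - |v| ^ 2) / 2)
  else 0

/-- The absolutely continuous part of the measure `χ^♭(ρ, ·)`. -/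
def chiFlatDensity (ρ v : ℝ) : ℝ :=
  if |v| < Real.log ρ then
    -(1 / 4 * √ρ * besselI 0 (√(Real.log ρ ^ 2 - |v| ^ 2) / 2))
      + 1 / 4 * √ρ * (Real.log ρ / √(Real.log ρ ^ 2 - |v| ^ 2))
        * besselI 1 (√(Real.log ρ ^ 2 - |v| ^ 2) / 2)
  else 0

/-- The measure `χ^♭(ρ, ·)`, given by its action on test functions:
`(1/2) √ρ (δ_{v = log ρ} + δ_{v = -log ρ})` plus the absolutely continuous part. -/
def chiFlat (ρ : ℝ) (φ : ℝ → ℝ) : ℝ :=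
  1 / 2 * √ρ * (φ (Real.log ρ) + φ (-Real.log ρ)) + distOf (chiFlatDensity ρ) φ

end

/-! Pairing a kernel `h` with all translates of a test function, `(r, w) ↦ ⟨h(r), φ(· + w)⟩`, turns
the weak equation into a classical one. For `r ≥ 1` one has `p' = 1` and `p'' = 0`, so for both `χ`
and `σ - uχ` this function solves `k_rr = k_ww / r²`. Putting `r = e^t` and `K = e^{-t/2} k` gives
the constant-coefficient equation `K_tt = K_ww + K/4`.

Riemann's method solves the latter. Its Riemann function is `I_0(√((T-t)² - v²)/2)`, and pairing it
with `K` over the slices `|v| ≤ T - t` of the backward cone from `(T, 0)`, together with the values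
of `K` at the two ends of the slice, gives a quantity independent of `t`
(`kleinGordon_representation`). Comparing `t = T` with `t = 0` yields the formula at `T = log ρ`:
the cone ends give the Dirac masses, the time derivative of the Riemann function gives the `I_1`
term, and `K_t = k_r - k/2` at `t = 0` gives `χ^♯` and the `-I_0` part of `χ^♭`.

Two analytic points remain. The smeared kernel and its `r`-derivative need joint continuity and
derivatives in `w`; a Taylor identity in `r` (`smearDeriv_eq`) expresses the `r`-derivative through
quantities already under control. The integrals over the cone must also be recognised as
distributional convolutions, which is Fubini plus differentiation under the integral
(`distConv_paramDeriv`). -/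

noncomputable section

/-! ### Power series of the Bessel functions -/

/-- The entire function `x ↦ ∑ x^k / (k! (k+n)!)`, the power series behind `I_n`. -/
def besselSeries (n : ℕ) (x : ℝ) : ℝ :=
  ∑' k : ℕ, x ^ k / ((k.factorial : ℝ) * ((k + n).factorial : ℝ))

lemma summable_besselSeries (n : ℕ) (x : ℝ) :
    Summable fun k : ℕ => x ^ k / ((k.factorial : ℝ) * ((k + n).factorial : ℝ)) := by
  refine Summable.of_norm_bounded (Real.summable_pow_div_factorial |x|) fun k => ?_
  rw [norm_div, norm_pow, Real.norm_eq_abs, Real.norm_eq_abs, abs_of_pos (by positivity :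
    (0 : ℝ) < (k.factorial : ℝ) * ((k + n).factorial : ℝ))]
  have h1 : (1 : ℝ) ≤ (k + n).factorial := by exact_mod_cast Nat.factorial_pos _
  have h2 : (0 : ℝ) < k.factorial := by positivity
  gcongr
  nlinarith

lemma besselSeries_zero : besselSeries 0 0 = 1 := by
  rw [besselSeries, tsum_eq_single 0]
  · simp
  · intro k hk
    simp [hk]

/-- Termwise differentiation, dominated on a ball around `0` containing `x`: the factor `k` cancels
into `k!`, and the index shift raises `n` by one. -/
lemma hasDerivAt_besselSeries (n : ℕ) (x : ℝ) :
    HasDerivAt (besselSeries n) (besselSeries (n + 1) x) x := by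
  set R : ℝ := |x| + 1
  have hR : 0 < R := by positivity
  have hshift : ∀ y : ℝ, ∀ k : ℕ,
      ((k + 1 : ℕ) : ℝ) * y ^ k / (((k + 1).factorial : ℝ) * ((k + 1 + n).factorial : ℝ))
        = y ^ k / ((k.factorial : ℝ) * ((k + (n + 1)).factorial : ℝ)) := by
    intro y k
    rw [Nat.factorial_succ, show k + 1 + n = k + (n + 1) by ring]
    push_cast
    field_simp
  have hu : Summable fun k : ℕ =>
      (k : ℝ) * R ^ (k - 1) / ((k.factorial : ℝ) * ((k + n).factorial : ℝ)) := by
    rw [← summable_nat_add_iff 1]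
    simp only [Nat.add_sub_cancel]
    simp_rw [hshift R]
    exact summable_besselSeries (n + 1) R
  have key := hasDerivAt_tsum_of_isPreconnected
    (g := fun (k : ℕ) (y : ℝ) => y ^ k / ((k.factorial : ℝ) * ((k + n).factorial : ℝ)))
    (g' := fun (k : ℕ) (y : ℝ) =>
      (k : ℝ) * y ^ (k - 1) / ((k.factorial : ℝ) * ((k + n).factorial : ℝ)))
    (t := Metric.ball 0 R) (y₀ := x) (y := x) hu Metric.isOpen_ball
    (convex_ball 0 R).isPreconnected
    (fun k y _ => (hasDerivAt_pow k y).div_const _)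
    (fun k y hy => by
      have hy' : |y| ≤ R := by
        have := mem_ball_zero_iff.1 hy
        exact this.le
      rw [norm_div, norm_mul, norm_pow, Real.norm_eq_abs, Real.norm_eq_abs, Real.norm_eq_abs,
        abs_of_nonneg (Nat.cast_nonneg k), abs_of_pos (by positivity :
          (0 : ℝ) < (k.factorial : ℝ) * ((k + n).factorial : ℝ))]
      gcongr)
    (by simp [R]) (summable_besselSeries n x) (by simp [R])
  suffices h : (∑' k : ℕ, (k : ℝ) * x ^ (k - 1) / ((k.factorial : ℝ) * ((k + n).factorial : ℝ)))
      = besselSeries (n + 1) x from h ▸ key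
  have hs : Summable fun k : ℕ =>
      (k : ℝ) * x ^ (k - 1) / ((k.factorial : ℝ) * ((k + n).factorial : ℝ)) := by
    rw [← summable_nat_add_iff 1]
    simp only [Nat.add_sub_cancel]
    simp_rw [hshift x]
    exact summable_besselSeries (n + 1) x
  rw [hs.tsum_eq_zero_add]
  simp only [Nat.add_sub_cancel, hshift x]
  simp [besselSeries]

lemma continuous_besselSeries (n : ℕ) : Continuous (besselSeries n) :=
  continuous_iff_continuousAt.2 fun x => (hasDerivAt_besselSeries n x).continuousAt

/-- The modified Bessel equation in the variable `x`, coefficientwise `1/(k! (k+2)!) + 1/((k+1)!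
(k+2)!) = 1/((k+1)!)²`. It makes the Riemann function solve the Klein–Gordon equation. -/
lemma besselSeries_ode (x : ℝ) :
    x * besselSeries 2 x + besselSeries 1 x = besselSeries 0 x := by
  have h0 := summable_besselSeries 0 x
  have h1 := summable_besselSeries 1 x
  have h2 := (summable_besselSeries 2 x).mul_left x
  rw [besselSeries, besselSeries, besselSeries, ← tsum_mul_left, h0.tsum_eq_zero_add,
    h1.tsum_eq_zero_add, add_comm, add_assoc, ← ((summable_nat_add_iff 1).2 h1).tsum_add h2]
  congr 1
  · simp only [Nat.add_zero]
    congr 1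
    ext k
    rw [show k + 1 + 1 = k + 2 by ring,
      show (k + 2).factorial = (k + 2) * ((k + 1) * k.factorial) by
        rw [Nat.factorial_succ, Nat.factorial_succ], Nat.factorial_succ]
    push_cast
    field_simp
    ring

/-- Removes the square root from the kernels: the series in the squared argument is smooth across
the light cone. -/
lemma besselI_eq (n : ℕ) (x : ℝ) :
    besselI n x = (x / 2) ^ n * besselSeries n ((x / 2) ^ 2) := by
  rw [besselI, besselSeries, ← tsum_mul_left]
  congr 1
  ext k
  rw [pow_add, pow_mul]
  ring

/-! ### Riemann's method for the Klein–Gordon equation -/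

/-- Chain rule for `t ↦ f t (γ t)` from continuous partial derivatives of `f`. -/
lemma hasDerivAt_comp_curve {f f₁ f₂ : ℝ → ℝ → ℝ} {γ : ℝ → ℝ} {c t₀ : ℝ}
    (hf₁ : ∀ᶠ x : ℝ × ℝ in 𝓝 (t₀, γ t₀), HasDerivAt (fun t => f t x.2) (f₁ x.1 x.2) x.1)
    (hf₂ : ∀ᶠ x : ℝ × ℝ in 𝓝 (t₀, γ t₀), HasDerivAt (f x.1) (f₂ x.1 x.2) x.2)
    (hc₁ : ContinuousAt (fun x : ℝ × ℝ => f₁ x.1 x.2) (t₀, γ t₀))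
    (hc₂ : ContinuousAt (fun x : ℝ × ℝ => f₂ x.1 x.2) (t₀, γ t₀))
    (hγ : HasDerivAt γ c t₀) :
    HasDerivAt (fun t => f t (γ t)) (f₁ t₀ (γ t₀) + c * f₂ t₀ (γ t₀)) t₀ := by
  have key := hasStrictFDerivAt_uncurry_coprod (𝕜 := ℝ) (u := (t₀, γ t₀)) (f := f)
    (f₁ := fun t v => ContinuousLinearMap.toSpanSingleton ℝ (f₁ t v))
    (f₂ := fun t v => ContinuousLinearMap.toSpanSingleton ℝ (f₂ t v))
    (hf₁.mono fun x hx => hx.hasFDerivAt) (hf₂.mono fun x hx => hx.hasFDerivAt)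
    ((ContinuousLinearMap.toSpanSingletonCLE (𝕜 := ℝ) (E := ℝ)).continuous.continuousAt.comp hc₁)
    ((ContinuousLinearMap.toSpanSingletonCLE (𝕜 := ℝ) (E := ℝ)).continuous.continuousAt.comp hc₂)
  have h := key.hasFDerivAt.comp_hasDerivAt t₀ ((hasDerivAt_id t₀).prodMk hγ)
  refine h.congr_deriv ?_
  simp [Function.HasUncurry.uncurry]

lemma hasDerivAt_intervalIntegral_of_continuous {g g' : ℝ → ℝ → ℝ} {a b t : ℝ}
    (cg : Continuous (Function.uncurry g)) (cg' : Continuous (Function.uncurry g'))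
    (dg : ∀ t y, 0 < t → HasDerivAt (fun t => g t y) (g' t y) t) (ht : 0 < t) :
    HasDerivAt (fun t => ∫ y in a..b, g t y) (∫ y in a..b, g' t y) t := by
  obtain ⟨C, hC⟩ := (isCompact_Icc.prod isCompact_uIcc : IsCompact
    (Icc (t / 2) (t + 1) ×ˢ uIcc a b)).exists_bound_of_continuousOn cg'.continuousOn
  have cgt : ∀ t, Continuous (g t) := fun t => cg.comp (Continuous.prodMk_right t)
  have cgt' : ∀ t, Continuous (g' t) := fun t => cg'.comp (Continuous.prodMk_right t)
  exact (intervalIntegral.hasDerivAt_integral_of_dominated_loc_of_deriv_le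
    (bound := fun _ => C) (s := Icc (t / 2) (t + 1))
    (Icc_mem_nhds (by linarith) (by linarith))
    (Eventually.of_forall fun s => (cgt s).aestronglyMeasurable)
    ((cgt t).intervalIntegrable _ _) (cgt' t).aestronglyMeasurable
    (Eventually.of_forall fun y hy s hs => hC (s, y) ⟨hs, uIoc_subset_uIcc hy⟩) (by simp)
    (Eventually.of_forall fun y hy s hs => dg s y (by linarith [hs.1]))).2

/-- Representation of the solution of `k_tt = k_vv + k / 4`, `t ≥ 0`, at the point `(T, 0)` by
its Cauchy data at `t = 0`. -/
theorem kleinGordon_representation {k kt kv kvv ktv : ℝ → ℝ → ℝ} {T : ℝ} (hT : 0 ≤ T)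
    (hk : Continuous fun x : ℝ × ℝ => k x.1 x.2) (hkt : Continuous fun x : ℝ × ℝ => kt x.1 x.2)
    (hkv : Continuous fun x : ℝ × ℝ => kv x.1 x.2)
    (hkvv : Continuous fun x : ℝ × ℝ => kvv x.1 x.2)
    (hktv : Continuous fun x : ℝ × ℝ => ktv x.1 x.2)
    (dt : ∀ t v, HasDerivAt (fun t => k t v) (kt t v) t)
    (dv : ∀ t v, HasDerivAt (k t) (kv t v) v)
    (dvv : ∀ t v, HasDerivAt (kv t) (kvv t v) v)
    (dtv : ∀ t v, HasDerivAt (kt t) (ktv t v) v)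
    (dtt : ∀ t v, 0 ≤ t → HasDerivAt (fun t => kt t v) (kvv t v + k t v / 4) t) :
    2 * k T 0 = (∫ v in (-T)..T, (besselSeries 0 ((T ^ 2 - v ^ 2) / 16) * kt 0 v
      + T / 8 * besselSeries 1 ((T ^ 2 - v ^ 2) / 16) * k 0 v)) + k 0 T + k 0 (-T) := by
  have hG : ∀ n, Continuous (besselSeries n) := continuous_besselSeries
  have dG : ∀ n x, HasDerivAt (besselSeries n) (besselSeries (n + 1) x) x := hasDerivAt_besselSeries
  -- The substitution `v = (T - t) y` fixes the slice of the cone to `-1 ≤ y ≤ 1`; `z` is `((T-t)² -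
  -- v²)/16` in these coordinates.
  set z : ℝ → ℝ → ℝ := fun t y => (T - t) ^ 2 * (1 - y ^ 2) / 16 with hz
  have hzc : Continuous fun x : ℝ × ℝ => z x.1 x.2 := by fun_prop
  have hLc : Continuous fun x : ℝ × ℝ => (x.1, (T - x.1) * x.2) := by fun_prop
  have cG : ∀ n, Continuous fun x : ℝ × ℝ => besselSeries n (z x.1 x.2) :=
    fun n => (hG n).comp hzc
  have ck := hk.comp hLc
  have ckt := hkt.comp hLc
  have ckv := hkv.comp hLc
  have ckvv := hkvv.comp hLc
  have cktv := hktv.comp hLc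
  simp only [Function.comp_def] at ck ckt ckv ckvv cktv
  -- With Riemann function `G`, this is `G k_t - G_t k` times the Jacobian `T - t`.
  set g : ℝ → ℝ → ℝ := fun t y => (T - t) * besselSeries 0 (z t y) * kt t ((T - t) * y)
    + (T - t) ^ 2 / 8 * besselSeries 1 (z t y) * k t ((T - t) * y) with hg
  set g' : ℝ → ℝ → ℝ := fun t y =>
    -besselSeries 1 (z t y) * ((T - t) ^ 2 * y / 8) * (kv t ((T - t) * y) - y * kt t ((T - t) * y))
      + besselSeries 0 (z t y) * ((T - t) * kvv t ((T - t) * y) - kt t ((T - t) * y)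
        - y * ((T - t) * ktv t ((T - t) * y))) with hg'
  have cg : Continuous (Function.uncurry g) := by
    have := cG 0
    have := cG 1
    simp only [hg, Function.uncurry_def]
    fun_prop
  have cg' : Continuous (Function.uncurry g') := by
    have := cG 0
    have := cG 1
    simp only [hg', Function.uncurry_def]
    fun_prop
  have dcurve : ∀ t y, HasDerivAt (fun t => (T - t) * y) (-y) t := fun t y => by
    simpa using ((hasDerivAt_id t).const_sub T).mul_const y
  have dk : ∀ t y, HasDerivAt (fun t => k t ((T - t) * y))
      (kt t ((T - t) * y) + -y * kv t ((T - t) * y)) t := fun t y =>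
    hasDerivAt_comp_curve (γ := fun t => (T - t) * y) (Eventually.of_forall fun x => dt _ _)
      (Eventually.of_forall fun x => dv _ _) hkt.continuousAt hkv.continuousAt (dcurve t y)
  have dkt : ∀ t y, 0 < t → HasDerivAt (fun t => kt t ((T - t) * y))
      (kvv t ((T - t) * y) + k t ((T - t) * y) / 4 + -y * ktv t ((T - t) * y)) t := by
    intro t y ht
    refine hasDerivAt_comp_curve (γ := fun t => (T - t) * y)
      (f₁ := fun t v => kvv t v + k t v / 4) ?_
      (Eventually.of_forall fun x => dtv _ _) (by fun_prop) hktv.continuousAt (dcurve t y)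
    filter_upwards [continuousAt_fst.eventually (lt_mem_nhds ht)] with x hx
    exact dtt _ _ (le_of_lt hx)
  have dz : ∀ t y, HasDerivAt (fun t => z t y) (-((T - t) * (1 - y ^ 2) / 8)) t := fun t y => by
    have := ((((hasDerivAt_id' t).const_sub T).fun_pow 2).mul_const (1 - y ^ 2)).div_const 16
    refine this.congr_deriv ?_
    norm_num
    ring
  have dg : ∀ t y, 0 < t → HasDerivAt (fun t => g t y) (g' t y) t := by
    intro t y ht
    have dL : HasDerivAt (fun t => T - t) (-1) t := by
      simpa using (hasDerivAt_id t).const_sub T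
    have h0 := (dG 0 (z t y)).comp t (dz t y)
    have h1 := (dG 1 (z t y)).comp t (dz t y)
    have := ((dL.mul h0).mul (dkt t y ht)).add
      ((((dL.pow 2).div_const 8).mul h1).mul (dk t y))
    refine this.congr_deriv ?_
    -- The Bessel equation cancels the `k/4` term against the derivatives of the kernel.
    have ode := besselSeries_ode (z t y)
    simp only [hg', Function.comp_def, Pi.mul_apply, Pi.pow_apply]
    rw [← ode]
    simp only [hz]
    norm_num
    ring
  -- The `t`-derivative of the integrand is an exact `y`-derivative, so only values at `y = ±1`
  -- survive integration.
  have dQ : ∀ t y, HasDerivAt (fun y => besselSeries 0 (z t y) *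
      (kv t ((T - t) * y) - y * kt t ((T - t) * y))) (g' t y) y := by
    intro t y
    have dzy : HasDerivAt (fun y => z t y) (-((T - t) ^ 2 * y / 8)) y := by
      have := ((((hasDerivAt_id' y).fun_pow 2).const_sub 1).const_mul ((T - t) ^ 2)).div_const 16
      refine this.congr_deriv ?_
      norm_num
      ring
    have dl : HasDerivAt (fun y => (T - t) * y) (T - t) y := by
      simpa using (hasDerivAt_id y).const_mul (T - t)
    have := ((dG 0 (z t y)).comp y dzy).mul
      (((dvv t ((T - t) * y)).comp y dl).sub
        ((hasDerivAt_id y).mul ((dtv t ((T - t) * y)).comp y dl)))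
    refine this.congr_deriv ?_
    simp only [hg', Function.comp_def, Pi.mul_apply, Pi.sub_apply, id]
    ring
  set Φ : ℝ → ℝ := fun t =>
    (∫ y in (-1 : ℝ)..1, g t y) + k t ((T - t) * 1) + k t ((T - t) * (-1)) with hΦ
  have cΦ : Continuous Φ := by
    have h1 := intervalIntegral.continuous_parametric_intervalIntegral_of_continuous'
      (μ := volume) cg (-1) 1
    have h2 : Continuous fun t => k t ((T - t) * 1) :=
      hk.comp (g := fun x : ℝ × ℝ => k x.1 x.2) (f := fun t => (t, (T - t) * 1)) (by fun_prop)
    have h3 : Continuous fun t => k t ((T - t) * (-1)) :=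
      hk.comp (g := fun x : ℝ × ℝ => k x.1 x.2) (f := fun t => (t, (T - t) * (-1))) (by fun_prop)
    exact (h1.add h2).add h3
  have dΦ : ∀ t, 0 < t → HasDerivAt Φ 0 t := by
    intro t ht
    have hint := hasDerivAt_intervalIntegral_of_continuous (a := -1) (b := 1) cg cg'
      (fun t y ht => dg t y ht) ht
    have hval := intervalIntegral.integral_eq_sub_of_hasDerivAt (a := -1) (b := 1) (fun y _ => dQ t y)
        ((cg'.comp (Continuous.prodMk_right t)).intervalIntegrable _ _)
    refine ((hint.add (dk t 1)).add (dk t (-1))).congr_deriv ?_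
    rw [hval]
    -- On the cone itself the Riemann function is `1`, so the boundary flux cancels the derivatives
    -- of `k` along the two edges.
    have e1 : z t 1 = 0 := by simp [hz]
    have e2 : z t (-1) = 0 := by simp [hz]
    rw [e1, e2, besselSeries_zero]
    ring
  have hconst : Φ T = Φ 0 := by
    rcases hT.eq_or_lt with rfl | hT
    · rfl
    obtain ⟨c, -, hc⟩ := exists_hasDerivAt_eq_slope Φ (fun _ => 0) hT cΦ.continuousOn
      fun t ht => dΦ t ht.1
    have := (div_eq_zero_iff.1 hc.symm).resolve_right (by linarith)
    linarith
  have hΦT : Φ T = 2 * k T 0 := by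
    simp [hΦ, hg]
    ring
  have hΦ0 : Φ 0 = (∫ v in (-T)..T, (besselSeries 0 ((T ^ 2 - v ^ 2) / 16) * kt 0 v
      + T / 8 * besselSeries 1 ((T ^ 2 - v ^ 2) / 16) * k 0 v)) + k 0 T + k 0 (-T) := by
    have := intervalIntegral.smul_integral_comp_mul_left (a := -1) (b := 1)
      (fun v => besselSeries 0 ((T ^ 2 - v ^ 2) / 16) * kt 0 v
        + T / 8 * besselSeries 1 ((T ^ 2 - v ^ 2) / 16) * k 0 v) T
    simp only [mul_neg, mul_one, smul_eq_mul] at this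
    rw [← this, ← intervalIntegral.integral_const_mul]
    simp only [hΦ, hg, hz, sub_zero, mul_one, mul_neg]
    congr 3
    ext y
    rw [show (T ^ 2 - (T * y) ^ 2) / 16 = T ^ 2 * (1 - y ^ 2) / 16 by ring]
    ring
  rw [← hΦT, hconst, hΦ0]

/-! ### Test functions and their translates -/

lemma IsTest.shift {φ : ℝ → ℝ} (hφ : IsTest φ) (w : ℝ) : IsTest fun u => φ (u + w) :=
  ⟨hφ.1.comp (contDiff_id.add contDiff_const),
    hφ.2.comp_homeomorph (Homeomorph.addRight w)⟩

lemma IsTest.deriv {φ : ℝ → ℝ} (hφ : IsTest φ) : IsTest (deriv φ) :=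
  ⟨hφ.1.deriv', hφ.2.deriv⟩

lemma deriv_shift (φ : ℝ → ℝ) (w : ℝ) :
    deriv (fun u => φ (u + w)) = fun u => deriv φ (u + w) :=
  funext fun u => deriv_comp_add_const φ w u

lemma IsTest.continuous {φ : ℝ → ℝ} (hφ : IsTest φ) : Continuous φ := hφ.1.continuous

lemma IsTest.hasDerivAt {φ : ℝ → ℝ} (hφ : IsTest φ) (u : ℝ) :
    HasDerivAt φ (_root_.deriv φ u) u :=
  (hφ.1.differentiable (by simp) u).hasDerivAt

/-- Translates of a test function by bounded amounts share a bound with compact support. -/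
lemma IsTest.exists_bound {φ : ℝ → ℝ} (hφ : IsTest φ) (W : ℝ) :
    ∃ C M : ℝ, 0 ≤ C ∧ ∀ w, |w| ≤ W → ∀ u,
      |φ (u + w)| ≤ (Icc (-M) M).indicator (fun _ => C) u := by
  obtain ⟨C, hC⟩ := hφ.2.exists_bound_of_continuous hφ.continuous
  obtain ⟨R, hR⟩ := (isBounded_iff_forall_norm_le.1 hφ.2.isCompact.isBounded)
  refine ⟨C, R + W, (norm_nonneg _).trans (hC 0), fun w hw u => ?_⟩
  by_cases hu : u ∈ Icc (-(R + W)) (R + W)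
  · rw [indicator_of_mem hu]
    exact hC _
  · rw [indicator_of_notMem hu]
    have : φ (u + w) = 0 := by
      by_contra h
      have h1 := abs_le.1 (hR _ (subset_tsupport φ h))
      have h2 := abs_le.1 hw
      exact hu ⟨by linarith, by linarith⟩
    simp [this]

lemma LocallyIntegrable.integrable_mul_test {g φ : ℝ → ℝ} (hg : LocallyIntegrable g)
    (hφ : Continuous φ) (hc : HasCompactSupport φ) : Integrable fun u => g u * φ u := by
  simpa [mul_comm, smul_eq_mul] using hg.integrable_smul_left_of_hasCompactSupport hφ hc

lemma integrable_abs_mul_indicator {g : ℝ → ℝ} (hg : LocallyIntegrable g) (M C : ℝ) :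
    Integrable fun u => |g u| * (Icc (-M) M).indicator (fun _ => C) u := by
  have h : Integrable ((Icc (-M) M).indicator fun u => |g u| * C) :=
    IntegrableOn.integrable_indicator
      ((hg.integrableOn_isCompact isCompact_Icc).abs.mul_const C) measurableSet_Icc
  refine h.congr (Eventually.of_forall fun u => ?_)
  by_cases hu : u ∈ Icc (-M) M <;> simp [hu]

/-- The constants do not depend on `g`, so one pair serves every slice of an evolution at once. -/
lemma IsTest.exists_distOf_bound {φ : ℝ → ℝ} (hφ : IsTest φ) (W : ℝ) :
    ∃ C M : ℝ, 0 ≤ C ∧ ∀ g : ℝ → ℝ, LocallyIntegrable g → ∀ w, |w| ≤ W →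
      |distOf g fun u => φ (u + w)| ≤ C * ∫ u in Icc (-M) M, |g u| := by
  obtain ⟨C, M, hC, hM⟩ := hφ.exists_bound W
  refine ⟨C, M, hC, fun g hg w hw => ?_⟩
  calc |distOf g fun u => φ (u + w)|
      ≤ ∫ u, |g u| * (Icc (-M) M).indicator (fun _ => C) u := by
        rw [← Real.norm_eq_abs]
        refine norm_integral_le_of_norm_le (integrable_abs_mul_indicator hg M C)
          (Eventually.of_forall fun u => ?_)
        rw [norm_mul]
        exact mul_le_mul_of_nonneg_left (hM w hw u) (norm_nonneg _)
    _ = C * ∫ u in Icc (-M) M, |g u| := by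
        rw [← integral_const_mul, ← integral_indicator measurableSet_Icc]
        congr 1
        ext u
        by_cases hu : u ∈ Icc (-M) M <;> simp [hu, mul_comm]

lemma hasDerivAt_distOf_shift {g φ : ℝ → ℝ} (hg : LocallyIntegrable g) (hφ : IsTest φ) (w : ℝ) :
    HasDerivAt (fun w => distOf g fun u => φ (u + w)) (distOf g fun u => deriv φ (u + w)) w := by
  obtain ⟨C, M, hC, hM⟩ := hφ.deriv.exists_bound (|w| + 1)
  have hint : ∀ {ψ : ℝ → ℝ} (_ : IsTest ψ) w, Integrable fun u => g u * ψ (u + w) := fun hψ w =>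
    LocallyIntegrable.integrable_mul_test hg (hψ.shift w).continuous (hψ.shift w).2
  refine (hasDerivAt_integral_of_dominated_loc_of_deriv_le
    (bound := fun u => |g u| * (Icc (-M) M).indicator (fun _ => C) u)
    (F' := fun w u => g u * deriv φ (u + w)) (Metric.ball_mem_nhds w one_pos)
    (Eventually.of_forall fun w => (hint hφ w).aestronglyMeasurable) (hint hφ w)
    (hint hφ.deriv w).aestronglyMeasurable (Eventually.of_forall fun u x hx => ?_)
    (integrable_abs_mul_indicator hg M C) (Eventually.of_forall fun u x hx => ?_)).2
  · rw [norm_mul]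
    refine mul_le_mul_of_nonneg_left (hM x ?_ u) (norm_nonneg _)
    have h1 : |x - w| < 1 := hx
    have h2 := abs_add_le (x - w) w
    rw [sub_add_cancel] at h2
    linarith
  · simpa using (HasDerivAt.comp_const_add u x (hφ.hasDerivAt (u + x))).const_mul (g u)

/-! ### Regularity of smeared evolutions -/

/-- A family `h r`, `r > 0`, of distributions (given by functions) with `h_rr = A`, for a source
`A` that is continuous in `r`, dominated locally uniformly over translates, and compatible with
translations. -/
structure IsRegularEvolution (h : ℝ → ℝ → ℝ) (A : ℝ → (ℝ → ℝ) → ℝ) : Prop where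
  slice : ∀ r : ℝ, 0 < r → LocallyIntegrable (h r)
  differentiableAt : ∀ φ, IsTest φ → ∀ r : ℝ, 0 < r →
    DifferentiableAt ℝ (fun r => distOf (h r) φ) r
  equation : ∀ φ, IsTest φ → ∀ r : ℝ, 0 < r →
    HasDerivAt (fun r => paramDeriv (fun r' => distOf (h r')) r φ) (A r φ) r
  source_continuousOn : ∀ φ, IsTest φ → ContinuousOn (fun r => A r φ) (Ioi 0)
  source_bound : ∀ φ, IsTest φ → ∀ a b W : ℝ, 0 < a → ∃ n : ℝ → ℝ, IntegrableOn n (Icc a b) ∧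
    ∀ q ∈ Icc a b, ∀ w, |w| ≤ W → |A q fun u => φ (u + w)| ≤ n q
  source_deriv : ∀ φ, IsTest φ → ∀ r : ℝ, 0 < r → ∀ w,
    HasDerivAt (fun w => A r fun u => φ (u + w)) (A r fun u => deriv φ (u + w)) w

/-- `⟨h(r), φ(· + w)⟩`. -/
def smear (h : ℝ → ℝ → ℝ) (φ : ℝ → ℝ) (r w : ℝ) : ℝ := distOf (h r) fun u => φ (u + w)

/-- `⟨h_r(r), φ(· + w)⟩`. -/
def smearDeriv (h : ℝ → ℝ → ℝ) (φ : ℝ → ℝ) (r w : ℝ) : ℝ :=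
  paramDeriv (fun r' => distOf (h r')) r fun u => φ (u + w)

/-- A Lipschitz bound in `w`, locally uniform in `r`, upgrades continuity in `r` along `w = w₀` to
joint continuity. -/
lemma continuousAt_of_bounded_partial {f f₂ : ℝ → ℝ → ℝ} {r₀ : ℝ} (hr₀ : 0 < r₀) (w₀ : ℝ)
    (hd : ∀ r, 0 < r → ∀ w, HasDerivAt (f r) (f₂ r w) w)
    (hc : ContinuousAt (fun r => f r w₀) r₀)
    (hb : ∀ a b W : ℝ, 0 < a → ∃ C, ∀ r ∈ Icc a b, ∀ w, |w| ≤ W → |f₂ r w| ≤ C) :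
    ContinuousAt (fun x : ℝ × ℝ => f x.1 x.2) (r₀, w₀) := by
  obtain ⟨C, hC⟩ := hb (r₀ / 2) (r₀ + 1) (|w₀| + 1) (by linarith)
  have h1 : Tendsto (fun x : ℝ × ℝ => f x.1 x.2 - f x.1 w₀) (𝓝 (r₀, w₀)) (𝓝 0) := by
    have hlim : Tendsto (fun x : ℝ × ℝ => C * ‖x.2 - w₀‖) (𝓝 (r₀, w₀)) (𝓝 0) := by
      have : Continuous fun x : ℝ × ℝ => C * ‖x.2 - w₀‖ := by fun_prop
      simpa using this.tendsto (r₀, w₀)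
    refine squeeze_zero_norm' ?_ hlim
    have hr : Icc (r₀ / 2) (r₀ + 1) ∈ 𝓝 r₀ := Icc_mem_nhds (by linarith) (by linarith)
    filter_upwards [prod_mem_nhds hr (Metric.ball_mem_nhds w₀ one_pos)] with x hx
    have h0 : 0 < x.1 := by linarith [hx.1.1]
    refine (convex_ball w₀ 1).norm_image_sub_le_of_norm_hasDerivWithin_le
      (f := f x.1) (f' := f₂ x.1) (fun y _ => (hd x.1 h0 y).hasDerivWithinAt)
      (fun y hy => hC x.1 hx.1 y ?_) (Metric.mem_ball_self one_pos) hx.2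
    have h1 : |y - w₀| < 1 := hy
    have h2 := abs_add_le (y - w₀) w₀
    rw [sub_add_cancel] at h2
    linarith
  have h2 : Tendsto (fun x : ℝ × ℝ => f x.1 w₀) (𝓝 (r₀, w₀)) (𝓝 (f r₀ w₀)) :=
    hc.tendsto.comp continuousAt_fst
  simpa [ContinuousAt] using h1.add h2

namespace IsRegularEvolution

variable {h : ℝ → ℝ → ℝ} {A : ℝ → (ℝ → ℝ) → ℝ} {φ : ℝ → ℝ}

lemma hasDerivAt_smear (H : IsRegularEvolution h A) (hφ : IsTest φ) {r : ℝ} (hr : 0 < r) (w : ℝ) :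
    HasDerivAt (fun r => smear h φ r w) (smearDeriv h φ r w) r :=
  (H.differentiableAt _ (hφ.shift w) r hr).hasDerivAt

lemma hasDerivAt_smearDeriv (H : IsRegularEvolution h A) (hφ : IsTest φ) {r : ℝ} (hr : 0 < r)
    (w : ℝ) : HasDerivAt (fun r => smearDeriv h φ r w) (A r fun u => φ (u + w)) r :=
  H.equation _ (hφ.shift w) r hr

lemma hasDerivAt_smear_right (H : IsRegularEvolution h A) (hφ : IsTest φ) {r : ℝ} (hr : 0 < r)
    (w : ℝ) : HasDerivAt (smear h φ r) (smear h (deriv φ) r w) w :=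
  hasDerivAt_distOf_shift (H.slice r hr) hφ w

lemma continuousOn_Icc_source (H : IsRegularEvolution h A) (hφ : IsTest φ) {a : ℝ} (ha : 0 < a)
    (b w : ℝ) : ContinuousOn (fun q => A q fun u => φ (u + w)) (Icc a b) :=
  (H.source_continuousOn _ (hφ.shift w)).mono fun _ hq => ha.trans_le hq.1

/-- Taylor's formula on `[a, a + 1]` with integral remainder, solved for the first derivative. It
transfers bounds and `w`-derivatives to `h_r`, which is only given as a derivative of pairings. -/
lemma smearDeriv_eq (H : IsRegularEvolution h A) (hφ : IsTest φ) {a : ℝ} (ha : 0 < a) (w : ℝ) :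
    smearDeriv h φ a w = smear h φ (a + 1) w - smear h φ a w
      - ∫ q in a..(a + 1), (a + 1 - q) * A q fun u => φ (u + w) := by
  have hab : a ≤ a + 1 := by linarith
  have key := intervalIntegral.integral_eq_sub_of_hasDerivAt (a := a) (b := a + 1)
    (f := fun q => (a + 1 - q) * smearDeriv h φ q w + smear h φ q w)
    (f' := fun q => (a + 1 - q) * A q fun u => φ (u + w))
    (fun q hq => by
      rw [uIcc_of_le hab] at hq
      have hq0 : 0 < q := ha.trans_le hq.1
      have := (((hasDerivAt_id' q).const_sub (a + 1)).mul
        (H.hasDerivAt_smearDeriv hφ hq0 w)).add (H.hasDerivAt_smear hφ hq0 w)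
      refine this.congr_deriv ?_
      ring)
    (ContinuousOn.intervalIntegrable (by
      rw [uIcc_of_le hab]
      exact (by fun_prop : Continuous fun q : ℝ => a + 1 - q).continuousOn.mul
        (H.continuousOn_Icc_source hφ ha _ w)))
  rw [key]
  ring

lemma exists_smear_bound_slice (H : IsRegularEvolution h A) (hφ : IsTest φ) {a : ℝ} (ha : 0 < a)
    (W : ℝ) : ∃ C, ∀ w, |w| ≤ W → |smear h φ a w| ≤ C := by
  obtain ⟨C, M, -, hC⟩ := hφ.exists_distOf_bound W
  exact ⟨_, fun w hw => hC _ (H.slice a ha) w hw⟩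

lemma exists_smearDeriv_bound_slice (H : IsRegularEvolution h A) (hφ : IsTest φ) {a : ℝ}
    (ha : 0 < a) (W : ℝ) : ∃ C, ∀ w, |w| ≤ W → |smearDeriv h φ a w| ≤ C := by
  obtain ⟨C₁, h₁⟩ := H.exists_smear_bound_slice hφ (a := a + 1) (by linarith) W
  obtain ⟨C₂, h₂⟩ := H.exists_smear_bound_slice hφ ha W
  obtain ⟨n, hn, hA⟩ := H.source_bound φ hφ a (a + 1) W ha
  refine ⟨C₁ + C₂ + ∫ q in a..(a + 1), n q, fun w hw => ?_⟩
  rw [H.smearDeriv_eq hφ ha w]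
  have h3 : |∫ q in a..(a + 1), (a + 1 - q) * A q fun u => φ (u + w)|
      ≤ ∫ q in a..(a + 1), n q := by
    rw [← Real.norm_eq_abs]
    refine intervalIntegral.norm_integral_le_of_norm_le (by linarith)
      (Eventually.of_forall fun q hq => ?_)
      ((intervalIntegrable_iff_integrableOn_Icc_of_le (by linarith)).2 hn)
    have := hA q ⟨hq.1.le, hq.2⟩ w hw
    rw [norm_mul, Real.norm_eq_abs, abs_of_nonneg (by linarith [hq.2])]
    exact (mul_le_of_le_one_left (norm_nonneg _) (by linarith [hq.1])).trans this
  refine (abs_sub _ _).trans (add_le_add ((abs_sub _ _).trans ?_) h3)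
  exact add_le_add (h₁ w hw) (h₂ w hw)

/-- The bound on the slice `r = a` is propagated by integrating the source, whose dominating
function is integrable in `r`. -/
lemma exists_smearDeriv_bound (H : IsRegularEvolution h A) (hφ : IsTest φ) (a b W : ℝ)
    (ha : 0 < a) : ∃ C, ∀ r ∈ Icc a b, ∀ w, |w| ≤ W → |smearDeriv h φ r w| ≤ C := by
  obtain ⟨C, hC⟩ := H.exists_smearDeriv_bound_slice hφ ha W
  obtain ⟨n, hn, hA⟩ := H.source_bound φ hφ a b W ha
  refine ⟨C + ∫ q in Icc a b, |n q|, fun r hr w hw => ?_⟩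
  have hcont := H.continuousOn_Icc_source hφ ha r w
  have key := intervalIntegral.integral_eq_sub_of_hasDerivAt (a := a) (b := r)
    (f := fun q => smearDeriv h φ q w) (f' := fun q => A q fun u => φ (u + w))
    (fun q hq => by
      rw [uIcc_of_le hr.1] at hq
      exact H.hasDerivAt_smearDeriv hφ (ha.trans_le hq.1) w)
    (ContinuousOn.intervalIntegrable (by rwa [uIcc_of_le hr.1]))
  have hle : |∫ q in a..r, A q fun u => φ (u + w)| ≤ ∫ q in Icc a b, |n q| := by
    have hnr : IntegrableOn (fun q => |n q|) (Icc a b) := hn.abs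
    rw [← Real.norm_eq_abs]
    refine (intervalIntegral.norm_integral_le_of_norm_le hr.1 (g := fun q => |n q|)
      (Eventually.of_forall fun q hq => ?_)
      ((intervalIntegrable_iff_integrableOn_Icc_of_le hr.1).2
        (hnr.mono_set (Icc_subset_Icc_right hr.2)))).trans ?_
    · exact (hA q ⟨hq.1.le, hq.2.trans hr.2⟩ w hw).trans (le_abs_self _)
    · rw [intervalIntegral.integral_of_le hr.1]
      exact setIntegral_mono_set hnr (Eventually.of_forall fun q => abs_nonneg _)
        (LE.le.eventuallyLE
          (Ioc_subset_Icc_self.trans (Icc_subset_Icc_right hr.2)))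
  have : smearDeriv h φ r w = smearDeriv h φ a w + ∫ q in a..r, A q fun u => φ (u + w) := by
    rw [key]; ring
  rw [this]
  exact (abs_add_le _ _).trans (add_le_add (hC w hw) hle)

lemma exists_smear_bound (H : IsRegularEvolution h A) (hφ : IsTest φ) (a b W : ℝ)
    (ha : 0 < a) : ∃ C, ∀ r ∈ Icc a b, ∀ w, |w| ≤ W → |smear h φ r w| ≤ C := by
  obtain ⟨C, hC⟩ := H.exists_smear_bound_slice hφ ha W
  obtain ⟨C', hC'⟩ := H.exists_smearDeriv_bound hφ a b W ha
  refine ⟨C + |C'| * (b - a), fun r hr w hw => ?_⟩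
  have hd := (convex_Icc a b).norm_image_sub_le_of_norm_hasDerivWithin_le
    (f := fun r => smear h φ r w) (f' := fun r => smearDeriv h φ r w) (C := |C'|)
    (fun y hy => (H.hasDerivAt_smear hφ (ha.trans_le hy.1) w).hasDerivWithinAt)
    (fun y hy => (hC' y hy w hw).trans (le_abs_self _)) (left_mem_Icc.2 (hr.1.trans hr.2)) hr
  simp only [Real.norm_eq_abs] at hd
  rw [abs_of_nonneg (sub_nonneg.2 hr.1)] at hd
  have h2 : |C'| * (r - a) ≤ |C'| * (b - a) :=
    mul_le_mul_of_nonneg_left (by linarith [hr.2]) (abs_nonneg _)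
  have h3 := abs_sub_abs_le_abs_sub (smear h φ r w) (smear h φ a w)
  linarith [hC w hw]

lemma hasDerivAt_smearDeriv_right (H : IsRegularEvolution h A) (hφ : IsTest φ) {a : ℝ}
    (ha : 0 < a) (w : ℝ) : HasDerivAt (smearDeriv h φ a) (smearDeriv h (deriv φ) a w) w := by
  have hab : a ≤ a + 1 := by linarith
  obtain ⟨n, hn, hA⟩ := H.source_bound _ hφ.deriv a (a + 1) (|w| + 1) ha
  have hcont : ∀ {ψ : ℝ → ℝ} (_ : IsTest ψ) w,
      ContinuousOn (fun q => (a + 1 - q) * A q fun u => ψ (u + w)) (uIcc a (a + 1)) := by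
    intro ψ hψ w
    rw [uIcc_of_le hab]
    exact (by fun_prop : Continuous fun q : ℝ => a + 1 - q).continuousOn.mul
      (H.continuousOn_Icc_source hψ ha _ w)
  have hint := (intervalIntegral.hasDerivAt_integral_of_dominated_loc_of_deriv_le
    (μ := volume) (a := a) (b := a + 1)
    (F := fun w q => (a + 1 - q) * A q fun u => φ (u + w))
    (F' := fun w q => (a + 1 - q) * A q fun u => deriv φ (u + w)) (bound := n)
    (Metric.ball_mem_nhds w one_pos)
    (Eventually.of_forall fun w => (hcont hφ w).intervalIntegrable.def'.aestronglyMeasurable)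
    (hcont hφ w).intervalIntegrable
    ((hcont hφ.deriv w).intervalIntegrable.def'.aestronglyMeasurable)
    (Eventually.of_forall fun q hq x hx => by
      rw [uIoc_of_le hab] at hq
      have h1 : |x - w| < 1 := hx
      have h2 := abs_add_le (x - w) w
      rw [sub_add_cancel] at h2
      have := hA q ⟨hq.1.le, hq.2⟩ x (by linarith)
      rw [norm_mul, Real.norm_eq_abs, abs_of_nonneg (by linarith [hq.2])]
      exact (mul_le_of_le_one_left (norm_nonneg _) (by linarith [hq.1])).trans this)
    ((intervalIntegrable_iff_integrableOn_Icc_of_le hab).2 hn)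
    (Eventually.of_forall fun q hq x _ => by
      rw [uIoc_of_le hab] at hq
      exact (H.source_deriv φ hφ q (ha.trans hq.1) x).const_mul _)).2
  rw [H.smearDeriv_eq hφ.deriv ha w]
  have := ((H.hasDerivAt_smear_right hφ (r := a + 1) (by linarith) w).sub
    (H.hasDerivAt_smear_right hφ ha w)).sub hint
  refine this.congr_of_eventuallyEq (Eventually.of_forall fun w => ?_)
  exact H.smearDeriv_eq hφ ha w

lemma continuousAt_smear (H : IsRegularEvolution h A) (hφ : IsTest φ) {r : ℝ} (hr : 0 < r)
    (w : ℝ) : ContinuousAt (fun x : ℝ × ℝ => smear h φ x.1 x.2) (r, w) :=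
  continuousAt_of_bounded_partial hr w (fun _ hr w => H.hasDerivAt_smear_right hφ hr w)
    (H.hasDerivAt_smear hφ hr w).continuousAt
    (fun a b W ha => H.exists_smear_bound hφ.deriv a b W ha)

lemma continuousAt_smearDeriv (H : IsRegularEvolution h A) (hφ : IsTest φ) {r : ℝ} (hr : 0 < r)
    (w : ℝ) : ContinuousAt (fun x : ℝ × ℝ => smearDeriv h φ x.1 x.2) (r, w) :=
  continuousAt_of_bounded_partial hr w (fun _ hr w => H.hasDerivAt_smearDeriv_right hφ hr w)
    (H.hasDerivAt_smearDeriv hφ hr w).continuousAt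
    (fun a b W ha => H.exists_smearDeriv_bound hφ.deriv a b W ha)

end IsRegularEvolution

/-! ### Pressure law and weak solutions -/

/-- A two-sided derivative is determined by its restriction to `[1, ∞)`; this covers the threshold
`r = 1`. -/
lemma deriv_eq_of_eqOn_Ici {f g : ℝ → ℝ} {c r : ℝ} (hf : DifferentiableAt ℝ f r)
    (hfg : ∀ x, 1 ≤ x → f x = g x) (hg : HasDerivAt g c r) (hr : 1 ≤ r) : deriv f r = c := by
  have h1 : HasDerivWithinAt f (deriv f r) (Ici 1) r := hf.hasDerivAt.hasDerivWithinAt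
  have h2 : HasDerivWithinAt f c (Ici 1) r := hg.hasDerivWithinAt.congr (fun x hx => hfg x hx)
    (hfg r hr)
  exact (uniqueDiffOn_Ici 1 r hr).eq_deriv _ h1 h2

namespace IsPressureLaw

variable {p : ℝ → ℝ}

lemma contDiffOn_deriv (hp : IsPressureLaw p) : ContDiffOn ℝ 1 (deriv p) (Ioi 0) :=
  hp.contDiffOn.deriv_of_isOpen isOpen_Ioi (by norm_num)

lemma continuousOn_deriv_deriv (hp : IsPressureLaw p) :
    ContinuousOn (deriv (deriv p)) (Ioi 0) :=
  hp.contDiffOn_deriv.continuousOn_deriv_of_isOpen isOpen_Ioi le_rfl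

lemma deriv_eq_one (hp : IsPressureLaw p) {r : ℝ} (hr : 1 ≤ r) : deriv p r = 1 :=
  deriv_eq_of_eqOn_Ici ((hp.contDiffOn.differentiableOn (by norm_num)).differentiableAt
    (Ioi_mem_nhds (by linarith))) hp.high_density (hasDerivAt_id r) hr

lemma deriv_deriv_eq_zero (hp : IsPressureLaw p) {r : ℝ} (hr : 1 ≤ r) :
    deriv (deriv p) r = 0 :=
  deriv_eq_of_eqOn_Ici ((hp.contDiffOn_deriv.differentiableOn (by norm_num)).differentiableAt
    (Ioi_mem_nhds (by linarith))) (fun _ hx => hp.deriv_eq_one hx) (hasDerivAt_const r 1) hr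

end IsPressureLaw

namespace IsWeakSolution

variable {p : ℝ → ℝ} {F F' : ℝ → (ℝ → ℝ) → ℝ} {g₀ g₁ g₀' g₁' : (ℝ → ℝ) → ℝ}
  {h X : ℝ → ℝ → ℝ} {e : ℝ → ℝ} {φ : ℝ → ℝ}

lemma continuousOn_distOf (H : IsWeakSolution p F g₀ g₁ h) (hφ : IsTest φ) :
    ContinuousOn (fun r => distOf (h r) φ) (Ioi 0) := fun r hr =>
  (H.differentiableAt φ hφ r hr).continuousAt.continuousWithinAt

/-- Local integrability in both variables and Fubini make the slice norms `∫ |h q u| du` over a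
compact interval integrable in `q`. -/
lemma exists_distOf_bound (H : IsWeakSolution p F g₀ g₁ h) (hφ : IsTest φ) (a b W : ℝ)
    (ha : 0 < a) : ∃ n : ℝ → ℝ, IntegrableOn n (Icc a b) ∧
      ∀ q ∈ Icc a b, ∀ w, |w| ≤ W → |distOf (h q) fun u => φ (u + w)| ≤ n q := by
  obtain ⟨C, M, -, hC⟩ := hφ.exists_distOf_bound W
  refine ⟨fun q => C * ∫ u in Icc (-M) M, |h q u|, ?_, fun q hq w hw =>
    hC _ (H.locallyIntegrable_slice q (ha.trans_le hq.1)) w hw⟩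
  have h1 : IntegrableOn (fun x : ℝ × ℝ => h x.1 x.2) (Icc a b ×ˢ Icc (-M) M) :=
    H.locallyIntegrableOn.integrableOn_compact_subset
      (prod_mono (fun q hq => ha.trans_le hq.1) (subset_univ _)) (isCompact_Icc.prod isCompact_Icc)
  rw [IntegrableOn, Measure.volume_eq_prod, ← Measure.prod_restrict] at h1
  exact h1.integral_norm_prod_left.const_mul C

/-- A weak solution whose source is a continuous multiple of the derivative of another weak
solution is a regular evolution. -/
lemma isRegularEvolution (hp : IsPressureLaw p) (H : IsWeakSolution p F g₀ g₁ h)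
    (HX : IsWeakSolution p F' g₀' g₁' X) (he : ContinuousOn e (Ioi 0))
    (hF : ∀ r φ, F r φ = e r * distOf (X r) (deriv φ)) :
    IsRegularEvolution h fun r φ =>
      deriv p r / r ^ 2 * distOf (h r) (deriv (deriv φ)) + e r * distOf (X r) (deriv φ) where
  slice := H.locallyIntegrable_slice
  differentiableAt := H.differentiableAt
  equation φ hφ r hr := by
    have := H.equation φ hφ r hr
    rwa [hF] at this
  source_continuousOn φ hφ := by
    refine ((hp.contDiffOn_deriv.continuousOn.div (by fun_prop) fun r hr => ?_).mul
      (H.continuousOn_distOf hφ.deriv.deriv)).add (he.mul (HX.continuousOn_distOf hφ.deriv))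
    exact pow_ne_zero 2 (ne_of_gt hr)
  source_bound φ hφ a b W ha := by
    have hsub : Icc a b ⊆ Ioi 0 := fun q hq => ha.trans_le hq.1
    have hc : ContinuousOn (fun r => deriv p r / r ^ 2) (Ioi 0) :=
      hp.contDiffOn_deriv.continuousOn.div (by fun_prop) fun r hr => pow_ne_zero 2 (ne_of_gt hr)
    obtain ⟨C₁, h₁⟩ := isCompact_Icc.exists_bound_of_continuousOn (hc.mono hsub)
    obtain ⟨C₂, h₂⟩ := isCompact_Icc.exists_bound_of_continuousOn (he.mono hsub)
    obtain ⟨n₁, i₁, b₁⟩ := H.exists_distOf_bound hφ.deriv.deriv a b W ha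
    obtain ⟨n₂, i₂, b₂⟩ := HX.exists_distOf_bound hφ.deriv a b W ha
    refine ⟨fun q => C₁ * n₁ q + C₂ * n₂ q, (i₁.const_mul C₁).add (i₂.const_mul C₂),
      fun q hq w hw => ?_⟩
    rw [deriv_shift, deriv_shift]
    refine (abs_add_le _ _).trans (add_le_add ?_ ?_)
    · rw [abs_mul]
      exact mul_le_mul (h₁ q hq) (b₁ q hq w hw) (abs_nonneg _)
        ((norm_nonneg _).trans (h₁ q hq))
    · rw [abs_mul]
      exact mul_le_mul (h₂ q hq) (b₂ q hq w hw) (abs_nonneg _)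
        ((norm_nonneg _).trans (h₂ q hq))
  source_deriv φ hφ r hr w := by
    simp only [deriv_shift]
    exact ((hasDerivAt_distOf_shift (H.locallyIntegrable_slice r hr) hφ.deriv.deriv w).const_mul
      _).add ((hasDerivAt_distOf_shift (HX.locallyIntegrable_slice r hr) hφ.deriv w).const_mul _)

end IsWeakSolution

/-! ### Convolution with compactly supported kernels -/

section Convolution

variable {g S φ : ℝ → ℝ} {W : ℝ}

lemma integrable_mul_kernel_mul_shift (hg : LocallyIntegrable g) (hφ : IsTest φ)
    (hS : Integrable S) (hW : ∀ w, W < |w| → S w = 0) :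
    Integrable (fun x : ℝ × ℝ => g x.1 * (S x.2 * φ (x.1 + x.2))) (volume.prod volume) := by
  obtain ⟨C, M, hC, hM⟩ := hφ.exists_bound W
  refine ((integrable_abs_mul_indicator hg M C).mul_prod hS.abs).mono' ?_
    (Eventually.of_forall fun x => ?_)
  · exact hg.aestronglyMeasurable.comp_fst.mul (hS.aestronglyMeasurable.comp_snd.mul
      (hφ.continuous.comp (continuous_fst.add continuous_snd)).aestronglyMeasurable)
  · rw [norm_mul, norm_mul, Real.norm_eq_abs, Real.norm_eq_abs, Real.norm_eq_abs]
    by_cases hw : |x.2| ≤ W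
    · calc |g x.1| * (|S x.2| * |φ (x.1 + x.2)|)
          ≤ |g x.1| * (|S x.2| * (Icc (-M) M).indicator (fun _ => C) x.1) := by
            gcongr
            exact hM _ hw _
        _ = _ := by ring
    · simp [hW _ (not_le.1 hw)]

lemma distOf_kernel_swap (hg : LocallyIntegrable g) (hφ : IsTest φ)
    (hS : Integrable S) (hW : ∀ w, W < |w| → S w = 0) :
    distOf g (fun u => distOf S fun w => φ (u + w))
      = distOf S fun w => distOf g fun u => φ (u + w) := by
  have h := integral_integral_swap (f := fun u w => g u * (S w * φ (u + w)))
    (integrable_mul_kernel_mul_shift hg hφ hS hW)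
  simp only [distOf, ← integral_const_mul]
  rw [h]
  congr! 4
  ring

lemma integrable_mul_distOf_kernel (hg : LocallyIntegrable g) (hφ : IsTest φ)
    (hS : Integrable S) (hW : ∀ w, W < |w| → S w = 0) :
    Integrable fun u => g u * distOf S fun w => φ (u + w) := by
  simpa only [distOf, ← integral_const_mul] using
    (integrable_mul_kernel_mul_shift hg hφ hS hW).integral_prod_left

namespace IsRegularEvolution

variable {h : ℝ → ℝ → ℝ} {A : ℝ → (ℝ → ℝ) → ℝ}

lemma continuous_smear_right (H : IsRegularEvolution h A) (hφ : IsTest φ) {r : ℝ} (hr : 0 < r) :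
    Continuous (smear h φ r) :=
  continuous_iff_continuousAt.2 fun w => (H.hasDerivAt_smear_right hφ hr w).continuousAt

lemma continuous_smearDeriv_right (H : IsRegularEvolution h A) (hφ : IsTest φ) {r : ℝ}
    (hr : 0 < r) : Continuous (smearDeriv h φ r) :=
  continuous_iff_continuousAt.2 fun w => (H.hasDerivAt_smearDeriv_right hφ hr w).continuousAt

lemma hasDerivAt_distOf_smear (H : IsRegularEvolution h A) (hφ : IsTest φ)
    (hS : Integrable S) (hW : ∀ w, W < |w| → S w = 0) {r : ℝ} (hr : 0 < r) :
    HasDerivAt (fun r => distOf S (smear h φ r)) (distOf S (smearDeriv h φ r)) r := by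
  obtain ⟨C, hC⟩ := H.exists_smearDeriv_bound hφ (r / 2) (r + 1) W (by linarith)
  obtain ⟨C', hC'⟩ := H.exists_smear_bound hφ (r / 2) (r + 1) W (by linarith)
  have hmem : Icc (r / 2) (r + 1) ∈ 𝓝 r := Icc_mem_nhds (by linarith) (by linarith)
  have hmeas : ∀ s, 0 < s → AEStronglyMeasurable (fun w => S w * smear h φ s w) := fun s hs =>
    hS.aestronglyMeasurable.mul (H.continuous_smear_right hφ hs).aestronglyMeasurable
  refine (hasDerivAt_integral_of_dominated_loc_of_deriv_le (F := fun r w => S w * smear h φ r w)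
    (F' := fun r w => S w * smearDeriv h φ r w) (bound := fun w => |S w| * C) hmem ?_ ?_
    (hS.aestronglyMeasurable.mul (H.continuous_smearDeriv_right hφ hr).aestronglyMeasurable)
    (Eventually.of_forall fun w s hs => ?_) (hS.abs.mul_const C)
    (Eventually.of_forall fun w s hs =>
      (H.hasDerivAt_smear hφ (by linarith [hs.1]) w).const_mul _)).2
  · filter_upwards [lt_mem_nhds hr] with s hs using hmeas s hs
  · refine (hS.abs.mul_const C').mono' (hmeas r hr) (Eventually.of_forall fun w => ?_)
    by_cases hw : |w| ≤ W
    · rw [norm_mul]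
      exact mul_le_mul_of_nonneg_left (hC' r (mem_of_mem_nhds hmem) w hw) (norm_nonneg _)
    · simp [hW _ (not_le.1 hw)]
  · by_cases hw : |w| ≤ W
    · rw [norm_mul]
      exact mul_le_mul_of_nonneg_left (hC s hs w hw) (norm_nonneg _)
    · simp [hW _ (not_le.1 hw)]

/-- Fubini moves the kernel outside the pairing near `r`, and then `d/dr` passes under its integral
by domination. -/
lemma distConv_paramDeriv (H : IsRegularEvolution h A) (hφ : IsTest φ)
    (hS : Integrable S) (hW : ∀ w, W < |w| → S w = 0) {r : ℝ} (hr : 0 < r) :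
    distConv (paramDeriv (fun r => distOf (h r)) r) (distOf S) φ
      = distOf S (smearDeriv h φ r) := by
  refine ((H.hasDerivAt_distOf_smear hφ hS hW hr).congr_of_eventuallyEq ?_).deriv
  filter_upwards [lt_mem_nhds hr] with s hs
  exact distOf_kernel_swap (H.slice s hs) hφ hS hW

end IsRegularEvolution

end Convolution

/-! ### The kernels in terms of the power series -/

lemma chiSharp_eq (ρ : ℝ) : chiSharp ρ = (Ioo (-Real.log ρ) (Real.log ρ)).indicator fun v =>
    1 / 2 * √ρ * besselSeries 0 ((Real.log ρ ^ 2 - v ^ 2) / 16) := by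
  ext v
  by_cases hv : |v| < Real.log ρ
  · have hz : 0 < Real.log ρ ^ 2 - v ^ 2 := by
      have := sq_lt_sq' (by linarith [abs_nonneg v]) hv
      rw [sq_abs] at this
      linarith
    rw [chiSharp, if_pos hv, indicator_of_mem (mem_Ioo.2 (abs_lt.1 hv)), besselI_eq, sq_abs, pow_zero, one_mul,
      div_pow, div_pow, Real.sq_sqrt hz.le]
    norm_num [div_div]
  · rw [chiSharp, if_neg hv, indicator_of_notMem fun h => hv (abs_lt.2 (mem_Ioo.1 h))]

lemma chiFlatDensity_eq (ρ : ℝ) :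
    chiFlatDensity ρ = (Ioo (-Real.log ρ) (Real.log ρ)).indicator fun v =>
      √ρ * (-(1 / 4) * besselSeries 0 ((Real.log ρ ^ 2 - v ^ 2) / 16)
        + Real.log ρ / 16 * besselSeries 1 ((Real.log ρ ^ 2 - v ^ 2) / 16)) := by
  ext v
  by_cases hv : |v| < Real.log ρ
  · have hz : 0 < Real.log ρ ^ 2 - v ^ 2 := by
      have := sq_lt_sq' (by linarith [abs_nonneg v]) hv
      rw [sq_abs] at this
      linarith
    have hs : √(Real.log ρ ^ 2 - v ^ 2) ≠ 0 := (Real.sqrt_pos.2 hz).ne'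
    have harg : (√(Real.log ρ ^ 2 - v ^ 2) / 2 / 2) ^ 2 = (Real.log ρ ^ 2 - v ^ 2) / 16 := by
      rw [div_pow, div_pow, Real.sq_sqrt hz.le]
      norm_num [div_div]
    rw [chiFlatDensity, if_pos hv, indicator_of_mem (mem_Ioo.2 (abs_lt.1 hv)), besselI_eq, besselI_eq, sq_abs,
      harg]
    field_simp
    ring
  · rw [chiFlatDensity, if_neg hv, indicator_of_notMem fun h => hv (abs_lt.2 (mem_Ioo.1 h))]

lemma integrable_indicator_Ioo {f : ℝ → ℝ} (hf : Continuous f) (a b : ℝ) :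
    Integrable ((Ioo a b).indicator f) :=
  (integrable_indicator_iff measurableSet_Ioo).2
    (hf.integrableOn_Icc.mono_set Ioo_subset_Icc_self)

lemma indicator_Ioo_eq_zero (f : ℝ → ℝ) (T w : ℝ) (hw : T < |w|) :
    (Ioo (-T) T).indicator f w = 0 :=
  indicator_of_notMem (fun h => not_lt_of_gt hw (abs_lt.2 (mem_Ioo.1 h))) f

lemma distOf_indicator_Ioo (f φ : ℝ → ℝ) {T : ℝ} (hT : 0 ≤ T) :
    distOf ((Ioo (-T) T).indicator f) φ = ∫ v in (-T)..T, f v * φ v := by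
  rw [intervalIntegral.integral_of_le (by linarith), integral_Ioc_eq_integral_Ioo,
    ← integral_indicator measurableSet_Ioo, distOf]
  congr 1
  ext v
  by_cases hv : v ∈ Ioo (-T) T <;> simp [hv]

/-! ### The representation formula -/

namespace IsRegularEvolution

variable {h : ℝ → ℝ → ℝ} {A : ℝ → (ℝ → ℝ) → ℝ} {φ : ℝ → ℝ}

lemma continuous_smear_exp (H : IsRegularEvolution h A) (hφ : IsTest φ) :
    Continuous fun x : ℝ × ℝ => smear h φ (Real.exp x.1) x.2 :=
  continuous_iff_continuousAt.2 fun x =>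
    ContinuousAt.comp (f := fun x : ℝ × ℝ => (Real.exp x.1, x.2))
      (H.continuousAt_smear hφ (Real.exp_pos x.1) x.2) (by fun_prop)

lemma continuous_smearDeriv_exp (H : IsRegularEvolution h A) (hφ : IsTest φ) :
    Continuous fun x : ℝ × ℝ => smearDeriv h φ (Real.exp x.1) x.2 :=
  continuous_iff_continuousAt.2 fun x =>
    ContinuousAt.comp (f := fun x : ℝ × ℝ => (Real.exp x.1, x.2))
      (H.continuousAt_smearDeriv hφ (Real.exp_pos x.1) x.2) (by fun_prop)

lemma smear_representation (H : IsRegularEvolution h A)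
    (hA : ∀ r, 1 ≤ r → ∀ φ, A r φ = 1 / r ^ 2 * distOf (h r) (deriv (deriv φ)))
    (hφ : IsTest φ) {T : ℝ} (hT : 0 ≤ T) :
    2 * (Real.exp (-T / 2) * smear h φ (Real.exp T) 0)
      = (∫ v in (-T)..T, (besselSeries 0 ((T ^ 2 - v ^ 2) / 16) *
          (smearDeriv h φ 1 v - 1 / 2 * smear h φ 1 v)
        + T / 8 * besselSeries 1 ((T ^ 2 - v ^ 2) / 16) * smear h φ 1 v))
        + smear h φ 1 T + smear h φ 1 (-T) := by
  have c0 := H.continuous_smear_exp hφ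
  have c1 := H.continuous_smear_exp hφ.deriv
  have c2 := H.continuous_smear_exp hφ.deriv.deriv
  have d0 := H.continuous_smearDeriv_exp hφ
  have d1 := H.continuous_smearDeriv_exp hφ.deriv
  have eneg : ∀ t, HasDerivAt (fun t => Real.exp (-t / 2)) (-(1 / 2) * Real.exp (-t / 2)) t :=
    fun t => by
      have := (((hasDerivAt_id' t).fun_neg).div_const 2).exp
      exact this.congr_deriv (by ring)
  have epos : ∀ t, HasDerivAt (fun t => Real.exp (t / 2)) (1 / 2 * Real.exp (t / 2)) t :=
    fun t => by
      have := ((hasDerivAt_id' t).div_const 2).exp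
      exact this.congr_deriv (by ring)
  have e1 : ∀ t, Real.exp (-t / 2) * Real.exp t = Real.exp (t / 2) := fun t => by
    rw [← Real.exp_add]; ring_nf
  have e2 : ∀ t, Real.exp (t / 2) * Real.exp t * (1 / Real.exp t ^ 2) = Real.exp (-t / 2) :=
    fun t => by
      rw [← e1]
      field_simp
  have ds : ∀ t v, HasDerivAt (fun t => smear h φ (Real.exp t) v)
      (smearDeriv h φ (Real.exp t) v * Real.exp t) t := fun t v =>
    (H.hasDerivAt_smear hφ (Real.exp_pos t) v).comp t (Real.hasDerivAt_exp t)
  have dsd : ∀ t v, HasDerivAt (fun t => smearDeriv h φ (Real.exp t) v)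
      ((A (Real.exp t) fun u => φ (u + v)) * Real.exp t) t := fun t v =>
    (H.hasDerivAt_smearDeriv hφ (Real.exp_pos t) v).comp t (Real.hasDerivAt_exp t)
  have dk : ∀ t v, HasDerivAt (fun t => Real.exp (-t / 2) * smear h φ (Real.exp t) v)
      (Real.exp (t / 2) * smearDeriv h φ (Real.exp t) v
        - 1 / 2 * (Real.exp (-t / 2) * smear h φ (Real.exp t) v)) t := fun t v => by
    refine ((eneg t).mul (ds t v)).congr_deriv ?_
    linear_combination smearDeriv h φ (Real.exp t) v * e1 t
  -- The factor `e^{-t/2}` removes the first-order term created by `r = e^t`, at the price of the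
  -- term `k/4`.
  have key := kleinGordon_representation (T := T)
    (k := fun t v => Real.exp (-t / 2) * smear h φ (Real.exp t) v)
    (kt := fun t v => Real.exp (t / 2) * smearDeriv h φ (Real.exp t) v
      - 1 / 2 * (Real.exp (-t / 2) * smear h φ (Real.exp t) v))
    (kv := fun t v => Real.exp (-t / 2) * smear h (deriv φ) (Real.exp t) v)
    (kvv := fun t v => Real.exp (-t / 2) * smear h (deriv (deriv φ)) (Real.exp t) v)
    (ktv := fun t v => Real.exp (t / 2) * smearDeriv h (deriv φ) (Real.exp t) v
      - 1 / 2 * (Real.exp (-t / 2) * smear h (deriv φ) (Real.exp t) v))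
    hT (by fun_prop) (by fun_prop) (by fun_prop) (by fun_prop) (by fun_prop) dk
    (fun t v => (H.hasDerivAt_smear_right hφ (Real.exp_pos t) v).const_mul _)
    (fun t v => (H.hasDerivAt_smear_right hφ.deriv (Real.exp_pos t) v).const_mul _)
    (fun t v => ((H.hasDerivAt_smearDeriv_right hφ (Real.exp_pos t) v).const_mul _).sub
      (((H.hasDerivAt_smear_right hφ (Real.exp_pos t) v).const_mul _).const_mul _))
    (fun t v ht => by
      refine (((epos t).mul (dsd t v)).sub ((dk t v).const_mul (1 / 2))).congr_deriv ?_
      rw [hA _ (Real.one_le_exp ht), deriv_shift, deriv_shift, ← e2]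
      simp only [smear]
      ring)
  simpa using key

theorem eq_distConv_add_distConv (H : IsRegularEvolution h A)
    (hA : ∀ r, 1 ≤ r → ∀ φ, A r φ = 1 / r ^ 2 * distOf (h r) (deriv (deriv φ)))
    (hφ : IsTest φ) {ρ : ℝ} (hρ : 1 ≤ ρ) :
    distOf (h ρ) φ = distConv (paramDeriv (fun r => distOf (h r)) 1) (distOf (chiSharp ρ)) φ
      + distConv (distOf (h 1)) (chiFlat ρ) φ := by
  set T := Real.log ρ with hTdef
  have hT : 0 ≤ T := Real.log_nonneg hρ
  have hexp : Real.exp T = ρ := Real.exp_log (by linarith)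
  have hsqrt : √ρ = Real.exp (T / 2) := by rw [← hexp, Real.exp_half]
  have hB : ∀ n, Continuous fun v : ℝ => besselSeries n ((T ^ 2 - v ^ 2) / 16) := fun n =>
    (continuous_besselSeries n).comp (by fun_prop)
  have hB0 := hB 0
  have hB1 := hB 1
  have cs := H.continuous_smear_right hφ one_pos
  have csd := H.continuous_smearDeriv_right hφ one_pos
  have hsharp : distConv (paramDeriv (fun r => distOf (h r)) 1) (distOf (chiSharp ρ)) φ
      = ∫ v in (-T)..T, 1 / 2 * √ρ * besselSeries 0 ((T ^ 2 - v ^ 2) / 16) *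
          smearDeriv h φ 1 v := by
    rw [chiSharp_eq, H.distConv_paramDeriv hφ (integrable_indicator_Ioo (by fun_prop) _ _)
      (indicator_Ioo_eq_zero _ _) one_pos, distOf_indicator_Ioo _ _ hT]
  have hflat : distConv (distOf (h 1)) (chiFlat ρ) φ
      = 1 / 2 * √ρ * (smear h φ 1 T + smear h φ 1 (-T))
        + ∫ v in (-T)..T, √ρ * (-(1 / 4) * besselSeries 0 ((T ^ 2 - v ^ 2) / 16)
          + T / 16 * besselSeries 1 ((T ^ 2 - v ^ 2) / 16)) * smear h φ 1 v := by
    have hg := H.slice 1 one_pos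
    have hi : ∀ w, Integrable fun u => h 1 u * φ (u + w) := fun w =>
      LocallyIntegrable.integrable_mul_test hg (hφ.shift w).continuous (hφ.shift w).2
    rw [← distOf_indicator_Ioo _ _ hT]
    rw [← chiFlatDensity_eq]
    have hS : Integrable (chiFlatDensity ρ) := by
      rw [chiFlatDensity_eq]
      exact integrable_indicator_Ioo (by fun_prop) _ _
    have hW : ∀ w, T < |w| → chiFlatDensity ρ w = 0 := by
      rw [chiFlatDensity_eq]
      exact indicator_Ioo_eq_zero _ _
    have hswap : distOf (chiFlatDensity ρ) (fun v => smear h φ 1 v)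
        = ∫ u, h 1 u * distOf (chiFlatDensity ρ) fun w => φ (u + w) :=
      (distOf_kernel_swap hg hφ hS hW).symm
    have hsum : Integrable fun u => 1 / 2 * √ρ * (h 1 u * φ (u + T) + h 1 u * φ (u + -T)) :=
      ((hi _).add (hi _)).const_mul _
    have hpair : smear h φ 1 T + smear h φ 1 (-T)
        = ∫ u, (h 1 u * φ (u + T) + h 1 u * φ (u + -T)) := (integral_add (hi _) (hi _)).symm
    rw [hswap, hpair, ← integral_const_mul,
      ← integral_add hsum (integrable_mul_distOf_kernel hg hφ hS hW)]
    refine integral_congr_ae (Eventually.of_forall fun u => ?_)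
    simp only [chiFlat, ← hTdef]
    ring
  have key := H.smear_representation hA hφ hT
  rw [hexp] at key
  have h0 : smear h φ ρ 0 = distOf (h ρ) φ := by simp [smear]
  rw [h0] at key
  have hone : Real.exp (T / 2) * Real.exp (-T / 2) = 1 := by
    rw [← Real.exp_add]; simp [neg_div]
  -- Undoes the rescaling: `√ρ = e^{T/2}` is the source of the prefactor of every kernel, with `1/2`
  -- from the two ends of the cone.
  have hmain : distOf (h ρ) φ = 1 / 2 * √ρ *
      (2 * (Real.exp (-T / 2) * distOf (h ρ) φ)) := by
    rw [hsqrt]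
    linear_combination -(distOf (h ρ) φ) * hone
  rw [hmain, key, hsharp, hflat, mul_add, mul_add, ← intervalIntegral.integral_const_mul]
  have hadd := intervalIntegral.integral_add (μ := volume) (a := -T) (b := T)
    (f := fun v => 1 / 2 * √ρ * besselSeries 0 ((T ^ 2 - v ^ 2) / 16) * smearDeriv h φ 1 v)
    (g := fun v => √ρ * (-(1 / 4) * besselSeries 0 ((T ^ 2 - v ^ 2) / 16)
          + T / 16 * besselSeries 1 ((T ^ 2 - v ^ 2) / 16)) * smear h φ 1 v)
    (Continuous.intervalIntegrable (by fun_prop) _ _)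
    (Continuous.intervalIntegrable (by fun_prop) _ _)
  rw [add_comm (1 / 2 * √ρ * (smear h φ 1 T + smear h φ 1 (-T))), ← add_assoc, ← hadd, mul_add,
    ← add_assoc]
  congr 2
  refine intervalIntegral.integral_congr fun v _ => ?_
  ring

end IsRegularEvolution

end

/-- For `ρ ≥ 1` and every `s`, as distributions in `u`,
`χ(ρ) = χ_ρ(1) * χ^♯(ρ) + χ(1) * χ^♭(ρ)`, and the same with `σ - u χ` in place of `χ`. -/
theorem theorem2p4 (p : ℝ → ℝ) (hp : IsPressureLaw p) (χ σ : ℝ → ℝ → ℝ → ℝ)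
    (hχ : IsEntropyKernel p χ) (hσ : IsEntropyFluxKernel p χ σ)
    (ρ : ℝ) (hρ : 1 ≤ ρ) (s : ℝ) :
    (∀ φ, IsTest φ →
      distOf (fun u => χ ρ u s) φ =
        distConv (paramDeriv (fun r => distOf (fun u => χ r u s)) 1) (distOf (chiSharp ρ)) φ
          + distConv (distOf (fun u => χ 1 u s)) (chiFlat ρ) φ) ∧
    (∀ φ, IsTest φ →
      distOf (fun u => σ ρ u s - u * χ ρ u s) φ =
        distConv (paramDeriv (fun r => distOf (fun u => σ r u s - u * χ r u s)) 1)
            (distOf (chiSharp ρ)) φ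
          + distConv (distOf (fun u => σ 1 u s - u * χ 1 u s)) (chiFlat ρ) φ) := by
  constructor
  · intro φ hφ
    -- The entropy equation has no source, so the coefficient is `0` and `χ` itself fills the
    -- auxiliary slot.
    have H := (hχ s).isRegularEvolution hp (hχ s) (e := fun _ => 0) continuousOn_const
      (fun r φ => by simp)
    exact H.eq_distConv_add_distConv (fun r hr φ => by rw [hp.deriv_eq_one hr]; ring) hφ hρ
  · intro φ hφ
    -- The minus sign comes from `⟨χ_u, φ⟩ = -⟨χ, φ'⟩`.
    have he : ContinuousOn (fun r => -(deriv (deriv p) r / r)) (Ioi 0) :=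
      (hp.continuousOn_deriv_deriv.div continuousOn_id fun r hr => ne_of_gt hr).neg
    have H := (hσ s).isRegularEvolution hp (hχ s) he (fun r φ => by ring)
    exact H.eq_distConv_add_distConv
      (fun r hr φ => by rw [hp.deriv_eq_one hr, hp.deriv_deriv_eq_zero hr]; ring) hφ hρ
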